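/- Let $H, H_1, H_2, H_3$ be complex Hilbert spaces (any of $H_1,H_2,H_3$ may be zero), let $a,b\in\mathbb{C}$, and let $P$ be a bounded linear operator on $H_3$ that is strictly positive, i.e. $\langle Ph,h\rangle>0$ for every $h\neq 0$ in $H_3$. Let $T$ be a bounded linear operator on $H$ that is unitarily similar to $$aI\oplus bI\oplus\begin{pmatrix} aI & P\\ 0 & bI\end{pmatrix}\quad\text{on}\quad H_1\oplus H_2\oplus(H_3\oplus H_3)$$ (so that $T$ is a quadratic operator: $(T-aI)(T-bI)=0$), and assume that both $a$ and $b$ belong to the spectrum of $T$ (this is automatic if $H_3\neq 0$, or if $H_1\neq0$ and $H_2\neq 0$). Then there exist bounded operators $A,B$ on $H$ with $T=AB$, $A$ and $B$ positive ($\langle Ah,h\rangle\ge 0$ and $\langle Bh,h\rangle\ge0$ for all $h\in H$), $\|A\|\le 1$ and $\|B\|\le 1$, if and only if $$a,b\in[0,1]\quad\text{and}\quad \|P\|\le\bigl|\sqrt a-\sqrt b\bigr|\,\sqrt{(1-a)(1-b)}.$$ -/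

import Mathlib

noncomputable section

/-- `A` is a positive contraction. -/
def IsPositiveContraction {H : Type*} [NormedAddCommGroup H] [InnerProductSpace ℂ H]
    (A : H →L[ℂ] H) : Prop :=
  A.IsPositive ∧ ‖A‖ ≤ 1

/-- `T` is a product of two positive contractions. -/
def IsProductOfTwoPositiveContractions {H : Type*} [NormedAddCommGroup H]
    [InnerProductSpace ℂ H] (T : H →L[ℂ] H) : Prop :=
  ∃ A B : H →L[ℂ] H, IsPositiveContraction A ∧ IsPositiveContraction B ∧ T = A * B

/-- `P > 0` in the sense that `⟨P h, h⟩ > 0` for every `h ≠ 0`. Invertibility of `P` is not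
required, so this is weaker than Mathlib's `IsStrictlyPositive`. -/
def IsPositiveDefiniteOperator {H : Type*} [NormedAddCommGroup H] [InnerProductSpace ℂ H]
    (P : H →L[ℂ] H) : Prop :=
  P.IsPositive ∧ ∀ h : H, h ≠ 0 → 0 < (inner ℂ (P h) h).re

/-- The operator with matrix `[[A, B], [C, D]]` on the Hilbert space direct sum `E ⊕ F`. -/
def blockOperator {E F : Type*} [NormedAddCommGroup E] [InnerProductSpace ℂ E]
    [NormedAddCommGroup F] [InnerProductSpace ℂ F]
    (A : E →L[ℂ] E) (B : F →L[ℂ] E) (C : E →L[ℂ] F) (D : F →L[ℂ] F) :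
    WithLp 2 (E × F) →L[ℂ] WithLp 2 (E × F) :=
  ((WithLp.prodContinuousLinearEquiv 2 ℂ E F).symm : E × F →L[ℂ] WithLp 2 (E × F)) ∘L
    ((A.coprod B).prod (C.coprod D)) ∘L
    (WithLp.prodContinuousLinearEquiv 2 ℂ E F : WithLp 2 (E × F) →L[ℂ] E × F)

/-- The operator `aI ⊕ bI ⊕ [[aI, P], [0, bI]]` on `H₁ ⊕ H₂ ⊕ (H₃ ⊕ H₃)`. -/
def quadraticModel {H₁ H₂ H₃ : Type*}
    [NormedAddCommGroup H₁] [InnerProductSpace ℂ H₁]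
    [NormedAddCommGroup H₂] [InnerProductSpace ℂ H₂]
    [NormedAddCommGroup H₃] [InnerProductSpace ℂ H₃]
    (a b : ℂ) (P : H₃ →L[ℂ] H₃) :
    WithLp 2 (H₁ × WithLp 2 (H₂ × WithLp 2 (H₃ × H₃))) →L[ℂ]
      WithLp 2 (H₁ × WithLp 2 (H₂ × WithLp 2 (H₃ × H₃))) :=
  blockOperator (a • ContinuousLinearMap.id ℂ H₁) 0 0
    (blockOperator (b • ContinuousLinearMap.id ℂ H₂) 0 0
      (blockOperator (a • ContinuousLinearMap.id ℂ H₃) P 0 (b • ContinuousLinearMap.id ℂ H₃)))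

end

open ContinuousLinearMap

/-! ### Positive contractions and the spectrum of their products -/

section PositiveContractions

variable {H : Type*} [NormedAddCommGroup H] [InnerProductSpace ℂ H]

/-! Write a = s², b = t² with s, t in [0,1]; a product of two positive contractions has spectrum in
[0,1]. For s ≠ t, everything reduces to the angle between the two eigenspaces of T: being such a
product is equivalent to (Re⟪u,v⟫)² (1+st)² ≤ (1-s²)(1-t²) ‖u‖² ‖v‖² for all eigenvectors u for s²,
v for t².

Necessity (`re_inner_sq_mul_le_of_eigenvectors`): u and v are orthogonal for the form ⟪B·,·⟫, and B
≤ I together with A² ≤ A bounds the Gram matrix of u, v. Sufficiency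
(`isProductOfTwoPositiveContractions_of_eigenvectors`): explicit factors are built from the
eigenprojections. In the model, (1+st)² = (1-s²)(1-t²) + (s+t)² turns the angle bound into the bound
on ‖P‖.

For s = t, T = AB must be scalar, which is P = 0. -/

theorem norm_sq_smul_add_smul (u v : H) (x y : ℝ) :
    ‖(x : ℂ) • u + (y : ℂ) • v‖ ^ 2
      = x ^ 2 * ‖u‖ ^ 2 + 2 * (x * y) * (inner ℂ u v).re + y ^ 2 * ‖v‖ ^ 2 := by
  have h := norm_add_sq (𝕜 := ℂ) ((x : ℂ) • u) ((y : ℂ) • v)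
  rw [h, inner_smul_left, inner_smul_right, norm_smul, norm_smul, mul_pow, mul_pow]
  simp
  ring

theorem IsPositiveContraction.re_inner_le {B : H →L[ℂ] H} (hB : IsPositiveContraction B) (x : H) :
    (inner ℂ (B x) x).re ≤ ‖x‖ ^ 2 := by
  have h1 : (inner ℂ (B x) x).re ≤ ‖B x‖ * ‖x‖ := re_inner_le_norm (𝕜 := ℂ) (B x) x
  have h2 : ‖B x‖ ≤ 1 * ‖x‖ := B.le_of_opNorm_le hB.2 x
  nlinarith [norm_nonneg x]

/-- An operator `A` with `‖A x‖² ≤ Re ⟪A x, x⟫` for all `x` is a contraction. -/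
theorem norm_le_one_of_norm_sq_le_re_inner {A : H →L[ℂ] H}
    (h : ∀ x, ‖A x‖ ^ 2 ≤ (inner ℂ (A x) x).re) : ‖A‖ ≤ 1 := by
  refine A.opNorm_le_bound zero_le_one fun x => ?_
  have h1 : (inner ℂ (A x) x).re ≤ ‖A x‖ * ‖x‖ := re_inner_le_norm (𝕜 := ℂ) (A x) x
  by_contra! hc
  nlinarith [h x, norm_nonneg x, norm_nonneg (A x)]

variable [CompleteSpace H]

theorem exists_isPositive_mul_self {A : H →L[ℂ] H} (hA : A.IsPositive) :
    ∃ S : H →L[ℂ] H, S.IsPositive ∧ A = S * S ∧ ‖S‖ ^ 2 = ‖A‖ := by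
  have hA' : 0 ≤ A := (nonneg_iff_isPositive A).2 hA
  have hS := (nonneg_iff_isPositive _).1 (CFC.sqrt_nonneg A)
  refine ⟨CFC.sqrt A, hS, (CFC.sqrt_mul_sqrt_self A hA').symm, ?_⟩
  conv_rhs => rw [← CFC.sqrt_mul_sqrt_self A hA']
  have := CStarRing.norm_star_mul_self (x := CFC.sqrt A)
  rw [hS.isSelfAdjoint.star_eq] at this
  rw [this, sq]

theorem IsPositiveContraction.norm_sq_le_re_inner {A : H →L[ℂ] H} (hA : IsPositiveContraction A)
    (x : H) : ‖A x‖ ^ 2 ≤ (inner ℂ (A x) x).re := by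
  obtain ⟨S, hS, rfl, hn⟩ := exists_isPositive_mul_self hA.1
  have hS1 : ‖S‖ ≤ 1 := by nlinarith [hA.2, norm_nonneg S]
  have h1 : inner ℂ ((S * S) x) x = inner ℂ (S x) (S x) := hS.inner_left_eq_inner_right _ _
  have h2 : ‖S (S x)‖ ≤ 1 * ‖S x‖ := S.le_of_opNorm_le hS1 _
  have h3 : (inner ℂ (S x) (S x)).re = ‖S x‖ ^ 2 := inner_self_eq_norm_sq (𝕜 := ℂ) (S x)
  rw [h1, h3]
  exact pow_le_pow_left₀ (norm_nonneg _) (by simpa using h2) 2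

theorem ContinuousLinearMap.IsPositive.apply_eq_zero_of_re_inner_eq_zero {A : H →L[ℂ] H}
    (hA : A.IsPositive) {x : H} (hx : (inner ℂ (A x) x).re = 0) : A x = 0 := by
  obtain ⟨S, hS, rfl, -⟩ := exists_isPositive_mul_self hA
  have h1 : inner ℂ ((S * S) x) x = inner ℂ (S x) (S x) := hS.inner_left_eq_inner_right _ _
  have h3 : (inner ℂ (S x) (S x)).re = ‖S x‖ ^ 2 := inner_self_eq_norm_sq (𝕜 := ℂ) (S x)
  rw [h1, h3] at hx
  have : S x = 0 := by simpa using hx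
  simp [this]

theorem ContinuousLinearMap.IsPositive.isPositiveContraction_of_re_inner_le {B : H →L[ℂ] H}
    (hB : B.IsPositive) (h : ∀ x, (inner ℂ (B x) x).re ≤ ‖x‖ ^ 2) : IsPositiveContraction B := by
  refine ⟨hB, ?_⟩
  obtain ⟨S, hS, rfl, hn⟩ := exists_isPositive_mul_self hB
  have hS1 : ‖S‖ ≤ 1 := by
    refine S.opNorm_le_bound zero_le_one fun x => ?_
    have h1 : inner ℂ ((S * S) x) x = inner ℂ (S x) (S x) := hS.inner_left_eq_inner_right _ _
    have h3 : (inner ℂ (S x) (S x)).re = ‖S x‖ ^ 2 := inner_self_eq_norm_sq (𝕜 := ℂ) (S x)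
    have h4 := h x
    rw [h1, h3] at h4
    rw [one_mul]
    exact le_of_sq_le_sq h4 (norm_nonneg x)
  rw [← hn]
  exact pow_le_one₀ (norm_nonneg _) hS1

-- With A = S², the operators S(SB) and SBS have the same nonzero spectrum, and SBS is positive.
open scoped ComplexOrder in
theorem IsProductOfTwoPositiveContractions.exists_eq_ofReal_of_mem_spectrum {T : H →L[ℂ] H}
    (hT : IsProductOfTwoPositiveContractions T) {z : ℂ} (hz : z ∈ spectrum ℂ T) :
    ∃ r ∈ Set.Icc (0 : ℝ) 1, z = (r : ℂ) := by
  obtain ⟨A, B, hA, hB, rfl⟩ := hT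
  rcases eq_or_ne z 0 with rfl | hz0
  · exact ⟨0, by simp, by simp⟩
  have : Nontrivial H := by
    by_contra hH
    rw [not_nontrivial_iff_subsingleton] at hH
    have : Subsingleton (H →L[ℂ] H) := ⟨fun f g => ext fun x => Subsingleton.elim _ _⟩
    simp [spectrum.of_subsingleton] at hz
  have hn : ‖z‖ ≤ 1 := (spectrum.norm_le_norm_of_mem hz).trans <|
    (norm_mul_le A B).trans (mul_le_one₀ hA.2 (norm_nonneg _) hB.2)
  obtain ⟨S, hS, rfl, -⟩ := exists_isPositive_mul_self hA.1
  have hz' : z ∈ spectrum ℂ (S * (S * B)) \ {0} := by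
    rw [← mul_assoc]; exact ⟨hz, by simpa using hz0⟩
  rw [spectrum.nonzero_mul_comm] at hz'
  have hpos : (S * B * S).IsPositive := by
    have := hB.1.conj_adjoint S
    rwa [hS.isSelfAdjoint.adjoint_eq] at this
  have hz2 : 0 ≤ z := spectrum_nonneg_of_nonneg ((nonneg_iff_isPositive _).2 hpos) hz'.1
  obtain ⟨hr, hi⟩ := Complex.nonneg_iff.1 hz2
  exact ⟨z.re, ⟨hr, (Complex.re_le_norm z).trans hn⟩, Complex.ext rfl hi.symm⟩

end PositiveContractions

/-! ### Inequalities for binary quadratic forms -/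

/-- A nonnegative binary quadratic form has nonnegative diagonal coefficients and nonpositive discriminant. -/
theorem sq_le_mul_of_forall_quadratic_nonneg {p q r : ℝ}
    (h : ∀ x y : ℝ, 0 ≤ x ^ 2 * p + 2 * (x * y) * q + y ^ 2 * r) :
    0 ≤ p ∧ 0 ≤ r ∧ q ^ 2 ≤ p * r := by
  refine ⟨by simpa using h 1 0, by simpa using h 0 1, ?_⟩
  have := discrim_le_zero (a := p) (b := 2 * q) (c := r) fun x => by linarith [h x 1]
  rw [discrim] at this
  linarith

/-- The hypotheses say that the matrices [[X-c, g], [g, Y-d]] and, after rescaling by s and t,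
[[c-s²X, -stg], [-stg, d-t²Y]] are positive semidefinite. Flipping the off-diagonal sign of the
second and adding cancels c and d; the claim is that the determinant of the sum is nonnegative. -/
theorem sq_mul_le_of_bounds {s t X Y g c d : ℝ} (hs : 0 ≤ s) (ht : 0 ≤ t)
    (hc : 0 ≤ c) (hd : 0 ≤ d)
    (h₁ : ∀ x y : ℝ, x ^ 2 * c + y ^ 2 * d ≤ x ^ 2 * X + 2 * (x * y) * g + y ^ 2 * Y)
    (h₂ : ∀ x y : ℝ, (x * s ^ 2) ^ 2 * X + 2 * ((x * s ^ 2) * (y * t ^ 2)) * g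
        + (y * t ^ 2) ^ 2 * Y ≤ x ^ 2 * s ^ 2 * c + y ^ 2 * t ^ 2 * d) :
    g ^ 2 * (1 + s * t) ^ 2 ≤ (1 - s ^ 2) * (1 - t ^ 2) * (X * Y) := by
  obtain ⟨hp, hr, hq⟩ := sq_le_mul_of_forall_quadratic_nonneg (p := X - c) (q := g) (r := Y - d)
    fun x y => by linarith [h₁ x y]
  obtain ⟨hp', hr', hq'⟩ := sq_le_mul_of_forall_quadratic_nonneg (p := s ^ 2 * (c - s ^ 2 * X))
    (q := - (s ^ 2 * t ^ 2 * g)) (r := t ^ 2 * (d - t ^ 2 * Y)) fun x y => by linarith [h₂ x y]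
  have hc' : 0 ≤ c - s ^ 2 * X := by
    rcases hs.eq_or_lt with rfl | hs
    · simpa using hc
    · exact nonneg_of_mul_nonneg_right hp' (by positivity)
  have hd' : 0 ≤ d - t ^ 2 * Y := by
    rcases ht.eq_or_lt with rfl | ht
    · simpa using hd
    · exact nonneg_of_mul_nonneg_right hr' (by positivity)
  have hst : (s * t * g) ^ 2 ≤ (c - s ^ 2 * X) * (d - t ^ 2 * Y) := by
    have h0 : 0 ≤ (c - s ^ 2 * X) * (d - t ^ 2 * Y) := mul_nonneg hc' hd'
    rcases (mul_nonneg hs ht).eq_or_lt with hst | hst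
    · rw [← hst]; simpa using h0
    · have : (s * t) ^ 2 * (s * t * g) ^ 2
          ≤ (s * t) ^ 2 * ((c - s ^ 2 * X) * (d - t ^ 2 * Y)) := by linarith
      exact le_of_mul_le_mul_left this (by positivity)
  -- AM-GM applied to the two determinant bounds; this is the mixed term of the determinant of the
  -- sum.
  have hcross : 2 * (g * (s * t * g))
      ≤ (X - c) * (d - t ^ 2 * Y) + (c - s ^ 2 * X) * (Y - d) := by
    refine le_of_sq_le_sq ?_ (by positivity)
    have h3 := mul_le_mul hq hst (sq_nonneg _) (mul_nonneg hp hr)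
    nlinarith [sq_nonneg ((X - c) * (d - t ^ 2 * Y) - (c - s ^ 2 * X) * (Y - d))]
  nlinarith

/-! ### Angle between eigenspaces and factorization -/

section QuadraticOperators

variable {H : Type*} [NormedAddCommGroup H] [InnerProductSpace ℂ H] [CompleteSpace H]

/-- AB is symmetric for ⟪B·,·⟫, so ⟪Bu,v⟫ = 0. On h = xu + yv, the two quadratic inequalities are
⟪Bh,h⟫ ≤ ‖h‖² and ‖ABh‖² ≤ ⟪ABh,Bh⟫. -/
theorem re_inner_sq_mul_le_of_eigenvectors {A B : H →L[ℂ] H} (hA : IsPositiveContraction A)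
    (hB : IsPositiveContraction B) {s t : ℝ} (hs : 0 ≤ s) (ht : 0 ≤ t) (hst : s ≠ t) {u v : H}
    (hu : A (B u) = ((s ^ 2 : ℝ) : ℂ) • u) (hv : A (B v) = ((t ^ 2 : ℝ) : ℂ) • v) :
    (inner ℂ u v).re ^ 2 * (1 + s * t) ^ 2
      ≤ (1 - s ^ 2) * (1 - t ^ 2) * (‖u‖ ^ 2 * ‖v‖ ^ 2) := by
  have hne : ((s ^ 2 : ℝ) : ℂ) ≠ ((t ^ 2 : ℝ) : ℂ) := fun h =>
    hst ((sq_eq_sq₀ hs ht).1 (Complex.ofReal_injective h))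
  have huv : inner ℂ (B u) v = 0 := by
    have h1 : inner ℂ (B u) (A (B v)) = inner ℂ (A (B u)) (B v) :=
      (hA.1.inner_left_eq_inner_right _ _).symm
    rw [hu, hv, inner_smul_left, inner_smul_right, ← hB.1.inner_left_eq_inner_right,
      Complex.conj_ofReal] at h1
    have h2 : (((t ^ 2 : ℝ) : ℂ) - ((s ^ 2 : ℝ) : ℂ)) * inner ℂ (B u) v = 0 := by
      rw [sub_mul, h1, sub_self]
    exact (mul_eq_zero.1 h2).resolve_left (sub_ne_zero.2 hne.symm)
  have hvu : inner ℂ (B v) u = 0 := by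
    rw [hB.1.inner_left_eq_inner_right, ← inner_conj_symm, huv, map_zero]
  have hform : ∀ x y z w : ℝ, (inner ℂ (B ((x : ℂ) • u + (y : ℂ) • v))
      ((z : ℂ) • u + (w : ℂ) • v)).re
      = x * z * (inner ℂ (B u) u).re + y * w * (inner ℂ (B v) v).re := by
    intro x y z w
    simp only [map_add, map_smul, inner_add_left, inner_add_right, inner_smul_left,
      inner_smul_right, huv, hvu, Complex.conj_ofReal, mul_zero, add_zero, zero_add,
      Complex.add_re, Complex.re_ofReal_mul]
    ring
  refine sq_mul_le_of_bounds (c := (inner ℂ (B u) u).re) (d := (inner ℂ (B v) v).re) hs ht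
    (hB.1.re_inner_nonneg_left u) (hB.1.re_inner_nonneg_left v) (fun x y => ?_) (fun x y => ?_)
  · have h := hB.re_inner_le ((x : ℂ) • u + (y : ℂ) • v)
    rw [hform, norm_sq_smul_add_smul] at h
    linarith
  · have hABh : A (B ((x : ℂ) • u + (y : ℂ) • v))
        = ((x * s ^ 2 : ℝ) : ℂ) • u + ((y * t ^ 2 : ℝ) : ℂ) • v := by
      rw [map_add, map_add, map_smul, map_smul, map_smul, map_smul, hu, hv, smul_smul, smul_smul,
        Complex.ofReal_mul, Complex.ofReal_mul]
    have h := hA.norm_sq_le_re_inner (B ((x : ℂ) • u + (y : ℂ) • v))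
    have hre : (inner ℂ (A (B ((x : ℂ) • u + (y : ℂ) • v))) (B ((x : ℂ) • u + (y : ℂ) • v))).re
        = (inner ℂ (B ((x : ℂ) • u + (y : ℂ) • v)) (A (B ((x : ℂ) • u + (y : ℂ) • v)))).re :=
      inner_re_symm (𝕜 := ℂ) _ _
    rw [hre, hABh, norm_sq_smul_add_smul, hform] at h
    linarith

/-- A symmetric operator has no Jordan block. Symmetry of AB for the semi-inner product ⟪B·,·⟫ makes
n = (AB-r)x null, so Bn = 0 and rn = 0. If r = 0, then BABx = 0 and positivity of A gives ABx = 0.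
-/
theorem apply_eq_smul_of_apply_sub_smul_eq_smul {A B : H →L[ℂ] H} (hA : A.IsPositive)
    (hB : B.IsPositive) (r : ℝ) {x : H}
    (hx : A (B (A (B x) - (r : ℂ) • x)) = (r : ℂ) • (A (B x) - (r : ℂ) • x)) :
    A (B x) = (r : ℂ) • x := by
  have hsymm : ∀ y z : H, inner ℂ (B (A (B y))) z = inner ℂ (B y) (A (B z)) := fun y z => by
    rw [hB.inner_left_eq_inner_right, hA.inner_left_eq_inner_right]
  set n := A (B x) - (r : ℂ) • x with hn
  have h0 : inner ℂ (B n) n = 0 := by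
    conv_lhs => enter [3]; rw [hn]
    rw [inner_sub_right, ← hsymm, hx, map_smul, inner_smul_left, inner_smul_right,
      Complex.conj_ofReal, sub_self]
  have hBn : B n = 0 := hB.apply_eq_zero_of_re_inner_eq_zero (by rw [h0, Complex.zero_re])
  rw [hBn, map_zero] at hx
  rcases smul_eq_zero.1 hx.symm with hr | h
  · have h1 : inner ℂ (A (B x)) (B x) = 0 := by
      rw [← hB.inner_left_eq_inner_right]
      have : B (A (B x)) = 0 := by simpa [hn, hr] using hBn
      rw [this, inner_zero_left]
    rw [hA.apply_eq_zero_of_re_inner_eq_zero (by rw [h1, Complex.zero_re]), hr, zero_smul]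
  · exact sub_eq_zero.1 h

theorem two_mul_abs_le_of_sq_mul_le {s t X Y g : ℝ} (hs : s ∈ Set.Icc (0 : ℝ) 1)
    (ht : t ∈ Set.Icc (0 : ℝ) 1) (hX : 0 ≤ X) (hY : 0 ≤ Y)
    (h : g ^ 2 * (1 + s * t) ^ 2 ≤ (1 - s ^ 2) * (1 - t ^ 2) * (X * Y)) :
    |2 * (1 + s * t) * g| ≤ (1 - s ^ 2) * X + (1 - t ^ 2) * Y := by
  have h1 : 0 ≤ 1 - s ^ 2 := by nlinarith [hs.1, hs.2]
  have h2 : 0 ≤ 1 - t ^ 2 := by nlinarith [ht.1, ht.2]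
  refine abs_le_of_sq_le_sq ?_ (by positivity)
  nlinarith [sq_nonneg ((1 - s ^ 2) * X - (1 - t ^ 2) * Y)]

/-- A quadratic operator whose two eigenspaces form a large enough angle is a product of two
positive contractions: the first factor is a combination of the orthogonal projections onto the
eigenspaces, the second one of the moduli of the spectral idempotents. -/
theorem isProductOfTwoPositiveContractions_of_eigenvectors {T : H →L[ℂ] H} {s t : ℝ}
    (hs : s ∈ Set.Icc (0 : ℝ) 1) (ht : t ∈ Set.Icc (0 : ℝ) 1) (hst : s ≠ t)
    (hT : ∀ x, T (T x - ((t ^ 2 : ℝ) : ℂ) • x)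
      = ((s ^ 2 : ℝ) : ℂ) • (T x - ((t ^ 2 : ℝ) : ℂ) • x))
    (hangle : ∀ u v : H, T u = ((s ^ 2 : ℝ) : ℂ) • u → T v = ((t ^ 2 : ℝ) : ℂ) • v →
      (inner ℂ u v).re ^ 2 * (1 + s * t) ^ 2
        ≤ (1 - s ^ 2) * (1 - t ^ 2) * (‖u‖ ^ 2 * ‖v‖ ^ 2)) :
    IsProductOfTwoPositiveContractions T := by
  have hs0 := hs.1
  have ht0 := ht.1
  have hpos : 0 < s + t := by
    rcases hs0.eq_or_lt with h | h
    · rcases ht0.eq_or_lt with h' | h'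
      · exact absurd (h.symm.trans h') hst
      · linarith
    · linarith
  have hone : 0 < 1 + s * t := by positivity
  have hne : ((s ^ 2 : ℝ) : ℂ) - ((t ^ 2 : ℝ) : ℂ) ≠ 0 := sub_ne_zero.2 fun h =>
    hst ((sq_eq_sq₀ hs0 ht0).1 (Complex.ofReal_injective h))
  set a : ℂ := ((s ^ 2 : ℝ) : ℂ) with ha
  set b : ℂ := ((t ^ 2 : ℝ) : ℂ) with hb
  have hangle' : ∀ u v : H, T u = a • u → T v = b • v →
      |2 * (1 + s * t) * (inner ℂ u v).re| ≤ (1 - s ^ 2) * ‖u‖ ^ 2 + (1 - t ^ 2) * ‖v‖ ^ 2 :=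
    fun u v hu hv => two_mul_abs_le_of_sq_mul_le hs ht (sq_nonneg _) (sq_nonneg _)
      (hangle u v hu hv)
  let U : Submodule ℂ H := (T - a • (1 : H →L[ℂ] H)).ker
  let V : Submodule ℂ H := (T - b • (1 : H →L[ℂ] H)).ker
  have hU : ∀ x, x ∈ U ↔ T x = a • x := fun x => by simp [U, sub_eq_zero]
  have hV : ∀ x, x ∈ V ↔ T x = b • x := fun x => by simp [V, sub_eq_zero]
  have : CompleteSpace U := (isClosed_ker (T - a • (1 : H →L[ℂ] H))).completeSpace_coe
  have : CompleteSpace V := (isClosed_ker (T - b • (1 : H →L[ℂ] H))).completeSpace_coe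
  let E := U.starProjection
  let F := V.starProjection
  let R : H →L[ℂ] H := (a - b)⁻¹ • (T - b • (1 : H →L[ℂ] H))
  let S : H →L[ℂ] H := (1 : H →L[ℂ] H) - R
  have hR : ∀ x, R x = (a - b)⁻¹ • (T x - b • x) := fun x => rfl
  have hRU : ∀ x, R x ∈ U := fun x => by
    refine U.smul_mem _ ((hU _).2 ?_)
    simpa using hT x
  have hSV : ∀ x, S x ∈ V := fun x => by
    have h1 : S x = (a - b)⁻¹ • (a • x - T x) := by
      have : x = (a - b)⁻¹ • (a - b) • x := by rw [smul_smul, inv_mul_cancel₀ hne, one_smul]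
      change x - R x = _
      nth_rewrite 1 [this]
      rw [hR, ← smul_sub]; congr 1; module
    rw [h1]
    refine V.smul_mem _ ((hV _).2 ?_)
    have h2 := hT x
    rw [map_sub, map_smul] at h2 ⊢
    rw [sub_eq_iff_eq_add.1 h2]; module
  have hRonU : ∀ x ∈ U, R x = x := fun x hx => by
    rw [hR, (hU x).1 hx, ← sub_smul, smul_smul, inv_mul_cancel₀ hne, one_smul]
  have hRonV : ∀ x ∈ V, R x = 0 := fun x hx => by
    simp [R, (hV x).1 hx]
  have hRS : ∀ x, R x + S x = x := fun x => by simp [S]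
  have hTRS : ∀ x, T x = a • R x + b • S x := fun x => by
    conv_lhs => rw [← hRS x]
    rw [map_add, (hU _).1 (hRU x), (hV _).1 (hSV x)]
  have hE : star E = E := (isSelfAdjoint_starProjection U).star_eq
  have hF : star F = F := (isSelfAdjoint_starProjection V).star_eq
  -- R and S are the spectral idempotents onto U and V. These adjoint relations remove the cross
  -- terms of the product, leaving s²R + t²S = T.
  have hER : E * star R = E := by
    have h : R * E = E := ext fun x => hRonU _ (U.starProjection_apply_mem x)
    simpa [hE] using congrArg star h
  have hFR : F * star R = 0 := by
    have h : R * F = 0 := ext fun x => hRonV _ (V.starProjection_apply_mem x)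
    simpa [hF] using congrArg star h
  have hES : E * star S = 0 := by simp [S, mul_sub, hER]
  have hFS : F * star S = F := by simp [S, mul_sub, hFR]
  have hERx : E * R = R := ext fun x => Submodule.starProjection_eq_self_iff.2 (hRU x)
  have hFSx : F * S = S := ext fun x => Submodule.starProjection_eq_self_iff.2 (hSV x)
  -- The scaling for which both contraction conditions, up to a nonnegative factor, reduce to the
  -- inequality `hangle'`.
  set m : ℝ := (1 + s * t) / (s + t) with hm
  have hm0 : 0 < m := by positivity
  have hnn : ∀ {x : ℝ}, 0 ≤ x → ∀ {C : H →L[ℂ] H}, C.IsPositive → ((x : ℂ) • C).IsPositive := by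
    intro x hx C hC
    have := hC.smul_of_nonneg (c := (x : ℂ)) (RCLike.ofReal_nonneg.2 hx)
    exact this
  refine ⟨((m * s : ℝ) : ℂ) • E + ((m * t : ℝ) : ℂ) • F,
    ((s / m : ℝ) : ℂ) • (star R * R) + ((t / m : ℝ) : ℂ) • (star S * S), ⟨?_, ?_⟩, ?_, ?_⟩
  · exact (hnn (by positivity) (IsPositive.of_isStarProjection isStarProjection_starProjection)).add
      (hnn (by positivity) (IsPositive.of_isStarProjection isStarProjection_starProjection))
  · refine norm_le_one_of_norm_sq_le_re_inner fun x => ?_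
    have h1 : (inner ℂ (E x) x).re = ‖E x‖ ^ 2 := by
      simpa using U.re_inner_starProjection_eq_normSq (𝕜 := ℂ) x
    have h2 : (inner ℂ (F x) x).re = ‖F x‖ ^ 2 := by
      simpa using V.re_inner_starProjection_eq_normSq (𝕜 := ℂ) x
    have h3 := (abs_le.1 (hangle' (E x) (F x) ((hU _).1 (U.starProjection_apply_mem x))
      ((hV _).1 (V.starProjection_apply_mem x)))).2
    rw [add_apply, smul_apply, smul_apply, norm_sq_smul_add_smul, inner_add_left, inner_smul_left,
      inner_smul_left, Complex.conj_ofReal, Complex.conj_ofReal, Complex.add_re,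
      Complex.re_ofReal_mul, Complex.re_ofReal_mul, h1, h2]
    have h4 : m * s - (m * s) ^ 2 = m * s * t / (s + t) * (1 - s ^ 2) := by
      rw [hm]; field_simp; ring
    have h5 : m * t - (m * t) ^ 2 = m * s * t / (s + t) * (1 - t ^ 2) := by
      rw [hm]; field_simp; ring
    have h6 : 2 * (m * s * (m * t)) = m * s * t / (s + t) * (2 * (1 + s * t)) := by
      rw [hm]; field_simp
    have h7 := mul_le_mul_of_nonneg_left h3 (show 0 ≤ m * s * t / (s + t) by positivity)
    linear_combination h7 - h4 * ‖E x‖ ^ 2 - h5 * ‖F x‖ ^ 2 + h6 * (inner ℂ (E x) (F x)).re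
  · refine ((hnn (by positivity) (isPositive_adjoint_comp_self R)).add
      (hnn (by positivity)
        (isPositive_adjoint_comp_self S))).isPositiveContraction_of_re_inner_le fun x => ?_
    have h1 : ∀ G : H →L[ℂ] H, (inner ℂ ((star G * G) x) x).re = ‖G x‖ ^ 2 := fun G => by
      rw [mul_apply_eq_comp, star_eq_adjoint, adjoint_inner_left]
      exact inner_self_eq_norm_sq (𝕜 := ℂ) (G x)
    have h3 := (abs_le.1 (hangle' (R x) (S x) ((hU _).1 (hRU x)) ((hV _).1 (hSV x)))).1
    have hx : ‖x‖ ^ 2 = ‖R x‖ ^ 2 + 2 * (inner ℂ (R x) (S x)).re + ‖S x‖ ^ 2 := by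
      have := norm_sq_smul_add_smul (R x) (S x) 1 1
      simpa [hRS] using this
    have hform : (inner ℂ ((((s / m : ℝ) : ℂ) • (star R * R)
        + ((t / m : ℝ) : ℂ) • (star S * S)) x) x).re = s / m * ‖R x‖ ^ 2 + t / m * ‖S x‖ ^ 2 := by
      rw [add_apply, smul_apply, smul_apply, inner_add_left, inner_smul_left,
        inner_smul_left, Complex.conj_ofReal, Complex.conj_ofReal, Complex.add_re,
        Complex.re_ofReal_mul, Complex.re_ofReal_mul, h1, h1]
    refine hform.trans_le ?_
    rw [hx]
    have h4 : 1 - s / m = (1 + s * t)⁻¹ * (1 - s ^ 2) := by rw [hm]; field_simp; ring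
    have h5 : 1 - t / m = (1 + s * t)⁻¹ * (1 - t ^ 2) := by rw [hm]; field_simp; ring
    have h6 : (2 : ℝ) = (1 + s * t)⁻¹ * (2 * (1 + s * t)) := by field_simp
    have h7 := mul_le_mul_of_nonneg_left h3 (inv_nonneg.2 hone.le)
    linear_combination h7 - h4 * ‖R x‖ ^ 2 - h5 * ‖S x‖ ^ 2 - h6 * (inner ℂ (R x) (S x)).re
  · have hAB : (((m * s : ℝ) : ℂ) • E + ((m * t : ℝ) : ℂ) • F)
        * (((s / m : ℝ) : ℂ) • (star R * R) + ((t / m : ℝ) : ℂ) • (star S * S))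
        = a • R + b • S := by
      simp only [add_mul, mul_add, smul_mul_assoc, mul_smul_comm, ← mul_assoc, hER, hFR, hES, hFS,
        smul_zero, add_zero, zero_add, hERx, hFSx, smul_smul, ← Complex.ofReal_mul]
      rw [ha, hb, show s / m * m * s = s ^ 2 by field_simp,
        show t / m * m * t = t ^ 2 by field_simp]
    rw [hAB]
    exact ext hTRS

end QuadraticOperators

/-! ### Coordinates in the model -/

theorem norm_sq_toLp {H₁ H₂ H₃ : Type*} [NormedAddCommGroup H₁]
    [NormedAddCommGroup H₂] [NormedAddCommGroup H₃] (x₁ : H₁) (x₂ : H₂) (x₃ x₄ : H₃) :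
    ‖WithLp.toLp 2 (x₁, WithLp.toLp 2 (x₂, WithLp.toLp 2 (x₃, x₄)))‖ ^ 2
      = ‖x₁‖ ^ 2 + (‖x₂‖ ^ 2 + (‖x₃‖ ^ 2 + ‖x₄‖ ^ 2)) := by
  simp [WithLp.prod_norm_sq_eq_of_L2]

theorem exists_eq_toLp {H₁ H₂ H₃ : Type*}
    (x : WithLp 2 (H₁ × WithLp 2 (H₂ × WithLp 2 (H₃ × H₃)))) :
    ∃ x₁ x₂ x₃ x₄, x = WithLp.toLp 2 (x₁, WithLp.toLp 2 (x₂, WithLp.toLp 2 (x₃, x₄))) :=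
  ⟨x.fst, x.snd.fst, x.snd.snd.fst, x.snd.snd.snd, rfl⟩

section Model

variable {H₁ H₂ H₃ : Type*}
  [NormedAddCommGroup H₁] [InnerProductSpace ℂ H₁]
  [NormedAddCommGroup H₂] [InnerProductSpace ℂ H₂]
  [NormedAddCommGroup H₃] [InnerProductSpace ℂ H₃]

theorem quadraticModel_toLp (a b : ℂ) (P : H₃ →L[ℂ] H₃) (x₁ : H₁) (x₂ : H₂) (x₃ x₄ : H₃) :
    quadraticModel a b P (WithLp.toLp 2 (x₁, WithLp.toLp 2 (x₂, WithLp.toLp 2 (x₃, x₄))))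
      = WithLp.toLp 2 (a • x₁, WithLp.toLp 2 (b • x₂, WithLp.toLp 2 (a • x₃ + P x₄, b • x₄))) := by
  simp [quadraticModel, blockOperator]

theorem inner_toLp (x₁ y₁ : H₁) (x₂ y₂ : H₂) (x₃ x₄ y₃ y₄ : H₃) :
    inner ℂ (WithLp.toLp 2 (x₁, WithLp.toLp 2 (x₂, WithLp.toLp 2 (x₃, x₄))))
      (WithLp.toLp 2 (y₁, WithLp.toLp 2 (y₂, WithLp.toLp 2 (y₃, y₄))))
      = inner ℂ x₁ y₁ + (inner ℂ x₂ y₂ + (inner ℂ x₃ y₃ + inner ℂ x₄ y₄)) := by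
  simp [WithLp.prod_inner_apply]

end Model

theorem eq_zero_of_smul_eq_smul_of_ne {E : Type*} [AddCommGroup E] [Module ℂ E] {c d : ℂ} {x : E}
    (hcd : c ≠ d) (hx : c • x = d • x) : x = 0 := by
  have h : (c - d) • x = 0 := by rw [sub_smul, hx, sub_self]
  exact (smul_eq_zero.1 h).resolve_left (sub_ne_zero.2 hcd)

/-! ### From the angle condition to the bound on ‖P‖ -/

section Main

variable {H H₁ H₂ H₃ : Type*}
  [NormedAddCommGroup H] [InnerProductSpace ℂ H] [CompleteSpace H]
  [NormedAddCommGroup H₁] [InnerProductSpace ℂ H₁]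
  [NormedAddCommGroup H₂] [InnerProductSpace ℂ H₂]
  [NormedAddCommGroup H₃] [InnerProductSpace ℂ H₃]
  {T : H →L[ℂ] H} {P : H₃ →L[ℂ] H₃}
  (U : H ≃ₗᵢ[ℂ] WithLp 2 (H₁ × WithLp 2 (H₂ × WithLp 2 (H₃ × H₃))))

theorem norm_le_of_isProductOfTwoPositiveContractions {s t : ℝ} (hs : s ∈ Set.Icc (0 : ℝ) 1)
    (ht : t ∈ Set.Icc (0 : ℝ) 1)
    (hT : ∀ x : H, U (T x) = quadraticModel ((s ^ 2 : ℝ) : ℂ) ((t ^ 2 : ℝ) : ℂ) P (U x))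
    (h : IsProductOfTwoPositiveContractions T) :
    ‖P‖ ≤ |s - t| * √((1 - s ^ 2) * (1 - t ^ 2)) := by
  obtain ⟨A, B, hA, hB, rfl⟩ := h
  have hs0 := hs.1
  have ht0 := ht.1
  have h1 : 0 ≤ 1 - s ^ 2 := by nlinarith [hs.1, hs.2]
  have h2 : 0 ≤ 1 - t ^ 2 := by nlinarith [ht.1, ht.2]
  refine P.opNorm_le_bound (by positivity) fun x => ?_
  -- For s = t, (T-s²)(0,0,0,x) = (0,0,Px,0) is killed by T-s², so it vanishes by the absence of
  -- Jordan blocks.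
  rcases eq_or_ne s t with rfl | hst
  · have hx : P x = 0 := by
      set w := U.symm (WithLp.toLp 2 (0, WithLp.toLp 2 (0, WithLp.toLp 2 (0, x)))) with hw
      have hn : A (B w) - ((s ^ 2 : ℝ) : ℂ) • w
          = U.symm (WithLp.toLp 2 (0, WithLp.toLp 2 (0, WithLp.toLp 2 (P x, 0)))) := by
        apply U.injective
        have := hT w
        rw [mul_apply_eq_comp] at this
        rw [map_sub, this, map_smul, hw, U.apply_symm_apply, U.apply_symm_apply,
          quadraticModel_toLp]
        simp [← WithLp.toLp_smul, ← WithLp.toLp_sub]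
      have hn' : A (B w) = ((s ^ 2 : ℝ) : ℂ) • w := by
        refine apply_eq_smul_of_apply_sub_smul_eq_smul hA.1 hB.1 _ ?_
        rw [hn]
        apply U.injective
        refine (hT _).trans ?_
        rw [map_smul, U.apply_symm_apply, quadraticModel_toLp]
        simp [← WithLp.toLp_smul]
      rw [hn', sub_self] at hn
      have h0 := congrArg U hn
      rw [map_zero, U.apply_symm_apply] at h0
      have h3 := congrArg (fun z => ‖z‖ ^ 2) h0
      simp only [norm_sq_toLp] at h3
      simpa using h3.symm
    simp [hx]
  · have hu := re_inner_sq_mul_le_of_eigenvectors hA hB hs0 ht0 hst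
      (u := U.symm (WithLp.toLp 2 (0, WithLp.toLp 2 (0, WithLp.toLp 2 (P x, 0)))))
      (v := U.symm (WithLp.toLp 2 (0, WithLp.toLp 2 (0, WithLp.toLp 2
        (P x, ((t ^ 2 - s ^ 2 : ℝ) : ℂ) • x)))))
      (by
        apply U.injective
        refine (hT _).trans ?_
        rw [map_smul, U.apply_symm_apply, quadraticModel_toLp]
        simp [← WithLp.toLp_smul])
      (by
        apply U.injective
        refine (hT _).trans ?_
        rw [map_smul, U.apply_symm_apply, quadraticModel_toLp, ← WithLp.toLp_smul, Prod.smul_mk,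
          ← WithLp.toLp_smul, Prod.smul_mk, ← WithLp.toLp_smul, Prod.smul_mk, map_smul, ← add_smul]
        simp)
    rw [LinearIsometryEquiv.inner_map_map, LinearIsometryEquiv.norm_map,
      LinearIsometryEquiv.norm_map, inner_toLp, norm_sq_toLp, norm_sq_toLp] at hu
    have hin : (inner ℂ (P x) (P x)).re = ‖P x‖ ^ 2 := inner_self_eq_norm_sq (𝕜 := ℂ) (P x)
    simp only [inner_zero_left, zero_add, add_zero, hin, norm_zero, ne_eq, OfNat.ofNat_ne_zero,
      not_false_eq_true, zero_pow, norm_smul, Complex.norm_real, Real.norm_eq_abs, mul_pow,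
      sq_abs] at hu
    rcases (norm_nonneg (P x)).eq_or_lt with hPx | hPx
    · rw [← hPx]; positivity
    have hpos : 0 < s + t := by
      rcases hs0.eq_or_lt with h | h
      · exact add_pos_of_nonneg_of_pos hs0 (ht0.lt_of_ne (h ▸ hst))
      · linarith
    refine le_of_sq_le_sq ?_ (by positivity)
    rw [mul_pow, mul_pow, sq_abs, Real.sq_sqrt (by positivity)]
    refine le_of_mul_le_mul_left ?_ (show 0 < ‖P x‖ ^ 2 * (s + t) ^ 2 by positivity)
    linear_combination hu

theorem isProductOfTwoPositiveContractions_of_norm_le {s t : ℝ} (hs : s ∈ Set.Icc (0 : ℝ) 1)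
    (ht : t ∈ Set.Icc (0 : ℝ) 1) (hst : s ≠ t)
    (hT : ∀ x : H, U (T x) = quadraticModel ((s ^ 2 : ℝ) : ℂ) ((t ^ 2 : ℝ) : ℂ) P (U x))
    (h : ‖P‖ ≤ |s - t| * √((1 - s ^ 2) * (1 - t ^ 2))) :
    IsProductOfTwoPositiveContractions T := by
  have h1 : 0 ≤ 1 - s ^ 2 := by nlinarith [hs.1, hs.2]
  have h2 : 0 ≤ 1 - t ^ 2 := by nlinarith [ht.1, ht.2]
  have hne : ((s ^ 2 : ℝ) : ℂ) ≠ ((t ^ 2 : ℝ) : ℂ) := fun h =>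
    hst ((sq_eq_sq₀ hs.1 ht.1).1 (Complex.ofReal_injective h))
  refine isProductOfTwoPositiveContractions_of_eigenvectors hs ht hst (fun x => ?_)
    (fun u v hu hv => ?_)
  · apply U.injective
    rw [hT, map_smul, map_sub, hT, map_smul]
    obtain ⟨x₁, x₂, x₃, x₄, hx⟩ := exists_eq_toLp (U x)
    rw [hx]
    simp only [quadraticModel_toLp, ← WithLp.toLp_smul, ← WithLp.toLp_sub, Prod.smul_mk,
      Prod.mk_sub_mk, sub_self, map_zero, smul_zero, add_zero]
  · obtain ⟨x₁, x₂, x₃, x₄, hx⟩ := exists_eq_toLp (U u)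
    obtain ⟨y₁, y₂, y₃, y₄, hy⟩ := exists_eq_toLp (U v)
    have hu' := hT u
    have hv' := hT v
    rw [hu, map_smul, hx, quadraticModel_toLp] at hu'
    rw [hv, map_smul, hy, quadraticModel_toLp] at hv'
    simp only [← WithLp.toLp_smul, Prod.smul_mk, WithLp.toLp.injEq, Prod.mk.injEq] at hu' hv'
    obtain ⟨-, hx₂, -, hx₄⟩ := hu'
    obtain ⟨hy₁, -, hy₃, -⟩ := hv'
    have hx₂' := eq_zero_of_smul_eq_smul_of_ne hne hx₂
    have hx₄' := eq_zero_of_smul_eq_smul_of_ne hne hx₄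
    have hy₁' := eq_zero_of_smul_eq_smul_of_ne hne.symm hy₁
    subst hx₂' hx₄' hy₁'
    -- Here u = (x₁,0,x₃,0) and v = (0,y₂,y₃,y₄) with (t²-s²)y₃ = Py₄, so the bound on P controls y₃
    -- by y₄.
    have hy₃' : ‖((t ^ 2 - s ^ 2 : ℝ) : ℂ) • y₃‖ ≤ ‖P‖ * ‖y₄‖ := by
      rw [Complex.ofReal_sub, sub_smul, hy₃, add_sub_cancel_left]
      exact P.le_opNorm y₄
    rw [← U.inner_map_map, ← U.norm_map u, ← U.norm_map v, hx, hy, inner_toLp, norm_sq_toLp,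
      norm_sq_toLp]
    simp only [inner_zero_left, inner_zero_right, zero_add, add_zero, norm_zero, ne_eq,
      OfNat.ofNat_ne_zero, not_false_eq_true, zero_pow]
    rw [norm_smul, Complex.norm_real, Real.norm_eq_abs] at hy₃'
    have hin : (inner ℂ x₃ y₃).re ^ 2 ≤ (‖x₃‖ * ‖y₃‖) ^ 2 :=
      sq_le_sq' (by
        have := abs_le.1 ((Complex.abs_re_le_norm _).trans (norm_inner_le_norm (𝕜 := ℂ) x₃ y₃))
        exact this.1) (re_inner_le_norm (𝕜 := ℂ) x₃ y₃)
    have hkey : (s + t) ^ 2 * ‖y₃‖ ^ 2 ≤ (1 - s ^ 2) * (1 - t ^ 2) * ‖y₄‖ ^ 2 := by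
      have h3 := pow_le_pow_left₀ (by positivity)
        (hy₃'.trans (mul_le_mul_of_nonneg_right h (norm_nonneg y₄))) 2
      rw [mul_pow, mul_pow, mul_pow, sq_abs, sq_abs, Real.sq_sqrt (by positivity)] at h3
      have hst' : 0 < (s - t) ^ 2 := by
        have := sub_ne_zero.2 hst
        positivity
      refine le_of_mul_le_mul_left ?_ hst'
      linear_combination h3
    calc (inner ℂ x₃ y₃).re ^ 2 * (1 + s * t) ^ 2
        ≤ (‖x₃‖ * ‖y₃‖) ^ 2 * (1 + s * t) ^ 2 := by gcongr
      _ = ‖x₃‖ ^ 2 * ((1 - s ^ 2) * (1 - t ^ 2) * ‖y₃‖ ^ 2 + (s + t) ^ 2 * ‖y₃‖ ^ 2) := by ring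
      _ ≤ ‖x₃‖ ^ 2 * ((1 - s ^ 2) * (1 - t ^ 2) * ‖y₃‖ ^ 2
            + (1 - s ^ 2) * (1 - t ^ 2) * ‖y₄‖ ^ 2) := by gcongr
      _ = (1 - s ^ 2) * (1 - t ^ 2) * (‖x₃‖ ^ 2 * (‖y₃‖ ^ 2 + ‖y₄‖ ^ 2)) := by ring
      _ ≤ (1 - s ^ 2) * (1 - t ^ 2) * ((‖x₁‖ ^ 2 + ‖x₃‖ ^ 2)
            * (‖y₂‖ ^ 2 + (‖y₃‖ ^ 2 + ‖y₄‖ ^ 2))) := by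
          refine mul_le_mul_of_nonneg_left (mul_le_mul ?_ ?_ ?_ ?_) (mul_nonneg h1 h2)
          · linarith [sq_nonneg ‖x₁‖]
          · linarith [sq_nonneg ‖y₂‖]
          · positivity
          · positivity

theorem isProductOfTwoPositiveContractions_of_eq_smul {r : ℝ} (hr : r ∈ Set.Icc (0 : ℝ) 1)
    (hT : ∀ x, T x = (r : ℂ) • x) : IsProductOfTwoPositiveContractions T := by
  refine ⟨(r : ℂ) • ContinuousLinearMap.id ℂ H, ContinuousLinearMap.id ℂ H, ⟨?_, ?_⟩,
    ⟨isPositive_id, norm_id_le⟩, ?_⟩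
  · exact isPositive_id.smul_of_nonneg (c := (r : ℂ)) (RCLike.ofReal_nonneg.2 hr.1)
  · rw [norm_smul, Complex.norm_real, Real.norm_of_nonneg hr.1]
    exact mul_le_one₀ hr.2 (norm_nonneg _) norm_id_le
  · exact ext fun x => hT x

end Main

theorem theorem1p1 {H H₁ H₂ H₃ : Type*}
    [NormedAddCommGroup H] [InnerProductSpace ℂ H] [CompleteSpace H]
    [NormedAddCommGroup H₁] [InnerProductSpace ℂ H₁] [CompleteSpace H₁]
    [NormedAddCommGroup H₂] [InnerProductSpace ℂ H₂] [CompleteSpace H₂]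
    [NormedAddCommGroup H₃] [InnerProductSpace ℂ H₃] [CompleteSpace H₃]
    (T : H →L[ℂ] H) (a b : ℂ) (P : H₃ →L[ℂ] H₃) (hP : IsPositiveDefiniteOperator P)
    (U : H ≃ₗᵢ[ℂ] WithLp 2 (H₁ × WithLp 2 (H₂ × WithLp 2 (H₃ × H₃))))
    (hT : ∀ x : H, U (T x) = quadraticModel a b P (U x))
    (ha : a ∈ spectrum ℂ T) (hb : b ∈ spectrum ℂ T) :
    IsProductOfTwoPositiveContractions T ↔
      ∃ α ∈ Set.Icc (0 : ℝ) 1, ∃ β ∈ Set.Icc (0 : ℝ) 1, a = (α : ℂ) ∧ b = (β : ℂ) ∧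
        ‖P‖ ≤ |√α - √β| * √((1 - α) * (1 - β)) := by
  have hsqrt : ∀ {r : ℝ}, r ∈ Set.Icc (0 : ℝ) 1 → √r ∈ Set.Icc (0 : ℝ) 1 := fun hr =>
    ⟨Real.sqrt_nonneg _, Real.sqrt_le_one.2 hr.2⟩
  constructor
  · intro h
    obtain ⟨α, hα, rfl⟩ := h.exists_eq_ofReal_of_mem_spectrum ha
    obtain ⟨β, hβ, rfl⟩ := h.exists_eq_ofReal_of_mem_spectrum hb
    refine ⟨α, hα, β, hβ, rfl, rfl, ?_⟩
    have := norm_le_of_isProductOfTwoPositiveContractions (P := P) U (hsqrt hα) (hsqrt hβ)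
      (by simpa only [Real.sq_sqrt hα.1, Real.sq_sqrt hβ.1] using hT) h
    rwa [Real.sq_sqrt hα.1, Real.sq_sqrt hβ.1] at this
  · rintro ⟨α, hα, β, hβ, rfl, rfl, h⟩
    rcases eq_or_ne α β with rfl | hne
    · have hP0 : P = 0 := by simpa using h
      refine isProductOfTwoPositiveContractions_of_eq_smul hα fun x => U.injective ?_
      obtain ⟨x₁, x₂, x₃, x₄, hx⟩ := exists_eq_toLp (U x)
      rw [hT, map_smul, hx, quadraticModel_toLp, hP0]
      simp [← WithLp.toLp_smul]
    · refine isProductOfTwoPositiveContractions_of_norm_le (P := P) U (hsqrt hα) (hsqrt hβ)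
        (fun hst => hne ((Real.sqrt_inj hα.1 hβ.1).1 hst)) ?_ ?_
      · simpa only [Real.sq_sqrt hα.1, Real.sq_sqrt hβ.1] using hT
      · rwa [Real.sq_sqrt hα.1, Real.sq_sqrt hβ.1]
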